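/- Let $M,N,Q$ be integers with $N\ge 0$ and $1\le Q\le M-1$, let $\mathbb F$ be $\mathbb R$ or $\mathbb C$, and let $\mathbf H_1,\dots,\mathbf H_M$ be $N\times N$ positive semidefinite matrices over $\mathbb F$ (real symmetric if $\mathbb F=\mathbb R$, complex Hermitian if $\mathbb F=\mathbb C$). For a parameter $0\le\epsilon\le 1$, let $v^{\min}_{\rm QP}$ be the optimal value of the mixed binary quadratic problem $$\min_{\mathbf w\in\mathbb F^N,\ \beta}\ \|\mathbf w\|^2\quad\text{s.t.}\quad \mathbf w^H\mathbf H_i\mathbf w\ \ge\ \beta_i+(1-\beta_i)\epsilon,\quad \beta_i\in\{0,1\}\quad (i=1,\dots,M),\qquad \sum_{i=1}^M\beta_i=Q,$$ where $\|\cdot\|$ is the Euclidean norm, and let $v^{\min}_{\rm SDP2}$ be the optimal value of its semidefinite relaxation $$\min_{\mathbf X\in\mathbb F^{N\times N},\ \beta\in\mathbb R^M}\ \mathrm{Tr}[\mathbf X]\quad\text{s.t.}\quad \mathrm{Tr}[\mathbf H_i\mathbf X]\ \ge\ \beta_i+(1-\beta_i)\epsilon,\quad 0\le\beta_i\le 1\quad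 (i=1,\dots,M),\qquad \sum_{i=1}^M\beta_i=Q,\qquad \mathbf X\succeq 0$$ ($\mathbf X$ real symmetric, respectively complex Hermitian). Optimal values are infima, equal to $+\infty$ if there is no feasible point. If $\epsilon=0$, then $$v^{\min}_{\rm QP}\ \le\ \frac{27\,Q^2\,(M-Q+1)}{\pi}\; v^{\min}_{\rm SDP2}\qquad\text{when }\mathbb F=\mathbb R,$$ and $$v^{\min}_{\rm QP}\ \le\ \max\{8Q,\ 24(\sqrt Q-1)^2\}\,(M-Q+1)\; v^{\min}_{\rm SDP2}\qquad\text{when }\mathbb F=\mathbb C .$$ -/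

import Mathlib

open scoped ComplexOrder

/-- Feasibility of `(w, β)` for the mixed binary quadratic problem: `wᴴ Hᵢ w ≥ βᵢ + (1 - βᵢ) ε`
for all `i`, `∑ᵢ βᵢ = Q`, and `βᵢ ∈ {0, 1}` for all `i`.
(For Hermitian `Hᵢ` the number `wᴴ Hᵢ w` is real.) -/
structure QPFeasible {𝕜 : Type*} [RCLike 𝕜] {M N : ℕ}
    (H : Fin M → Matrix (Fin N) (Fin N) 𝕜) (Q : ℕ) (ε : ℝ)
    (w : EuclideanSpace 𝕜 (Fin N)) (β : Fin M → ℝ) : Prop where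
  quad : ∀ i, β i * 1 + (1 - β i) * ε ≤
    RCLike.re (dotProduct (star (WithLp.ofLp w)) ((H i).mulVec (WithLp.ofLp w)))
  sum_eq : ∑ i, β i = (Q : ℝ)
  binary : ∀ i, β i = 0 ∨ β i = 1

/-- Feasibility of `(X, β)` for the semidefinite relaxation: `Tr(Hᵢ X) ≥ βᵢ + (1 - βᵢ) ε`
for all `i`, `∑ᵢ βᵢ = Q`, `0 ≤ βᵢ ≤ 1` for all `i`, and `X ⪰ 0`.
(For Hermitian `Hᵢ` and `X` the number `Tr(Hᵢ X)` is real.) -/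
structure SDPFeasible {𝕜 : Type*} [RCLike 𝕜] {M N : ℕ}
    (H : Fin M → Matrix (Fin N) (Fin N) 𝕜) (Q : ℕ) (ε : ℝ)
    (X : Matrix (Fin N) (Fin N) 𝕜) (β : Fin M → ℝ) : Prop where
  trace_ge : ∀ i, β i * 1 + (1 - β i) * ε ≤ RCLike.re (H i * X).trace
  sum_eq : ∑ i, β i = (Q : ℝ)
  box : ∀ i, 0 ≤ β i ∧ β i ≤ 1
  posSemidef : X.PosSemidef

/-- The optimal value of the mixed binary quadratic problem: the infimum of `‖w‖²` over all
feasible `(w, β)`, equal to `⊤` if there is none. -/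
noncomputable def vQPmin {𝕜 : Type*} [RCLike 𝕜] {M N : ℕ}
    (H : Fin M → Matrix (Fin N) (Fin N) 𝕜) (Q : ℕ) (ε : ℝ) : EReal :=
  ⨅ (w : EuclideanSpace 𝕜 (Fin N)) (β : Fin M → ℝ) (_ : QPFeasible H Q ε w β),
    ((‖w‖ ^ 2 : ℝ) : EReal)

/-- The optimal value of the semidefinite relaxation: the infimum of `Tr X` over all
feasible `(X, β)`, equal to `⊤` if there is none. -/
noncomputable def vSDP2min {𝕜 : Type*} [RCLike 𝕜] {M N : ℕ}
    (H : Fin M → Matrix (Fin N) (Fin N) 𝕜) (Q : ℕ) (ε : ℝ) : EReal :=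
  ⨅ (X : Matrix (Fin N) (Fin N) 𝕜) (β : Fin M → ℝ) (_ : SDPFeasible H Q ε X β),
    ((RCLike.re X.trace : ℝ) : EReal)

/-! Start from a feasible `(X, β)` and put `t = M - Q + 1`. Counting gives `Q` indices with `t * β i
≥ 1`, so `t • X` has `Tr (H i (t X)) ≥ 1` on this set `S`.

Factor `t X = Bᴴ B` and round to `w = Bᴴ z` with `z` Gaussian. Each `wᴴ H i w` is a sum of squares
`‖G i z‖²` with trace at least one, and `‖w‖²` has mean `Tr (t X)` times the second moment of the
scalar law. If every `z` had some `i ∈ S` with `c Tr(t X) ‖G i z‖² ≤ ‖w‖²`, then `1 ≤ e^{-x} + x` at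
`x = s ‖G i z‖²` would bound 1 by a sum of exponentials plus a multiple of `‖w‖²`. Integrating
contradicts `Q L(s) + (s / c) E|x|² < 1`, where `L` is the Laplace transform of `|x|²`. By Jensen,
rank one is the worst case for the exponentials (`integral_exp_neg_le`). The two fields differ only
in `L`, the second moment and the choice of `s`. -/

open MeasureTheory ProbabilityTheory

/-! ### Standard Gaussian laws: Laplace transform, second moment, rotation stability. -/

/-- The Laplace transform of the square of a standard real Gaussian variable. -/
lemma integral_exp_neg_mul_sq_gaussianReal {s : ℝ} (hs : 0 ≤ s) :
    ∫ x, Real.exp (-s * x ^ 2) ∂(gaussianReal 0 1) = (√(1 + 2 * s))⁻¹ := by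
  rw [integral_gaussianReal_eq_integral_smul one_ne_zero]
  have h : ∀ x : ℝ, gaussianPDFReal 0 1 x • Real.exp (-s * x ^ 2) =
      (√(2 * Real.pi))⁻¹ * Real.exp (-(s + 1 / 2) * x ^ 2) := by
    intro x
    simp only [gaussianPDFReal, NNReal.coe_one, mul_one, sub_zero, smul_eq_mul, mul_assoc]
    rw [← Real.exp_add]
    ring_nf
  simp_rw [h]
  rw [integral_const_mul, integral_gaussian, ← Real.sqrt_inv, ← Real.sqrt_inv,
    ← Real.sqrt_mul (by positivity)]
  congr 1
  have := Real.pi_pos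
  field_simp
  ring

lemma norm_sq_sum_smul_orthonormalBasis {ι E : Type*} [Fintype ι] [NormedAddCommGroup E]
    [InnerProductSpace ℝ E] (b : OrthonormalBasis ι ℝ E) (x : ι → ℝ) :
    ‖∑ i, x i • b i‖ ^ 2 = ∑ i, x i ^ 2 := by
  rw [← b.sum_sq_inner_right]
  refine Finset.sum_congr rfl fun i _ ↦ ?_
  rw [b.orthonormal.inner_right_fintype]

section StdGaussian

variable {E : Type*} [NormedAddCommGroup E] [InnerProductSpace ℝ E] [FiniteDimensional ℝ E]
  [MeasurableSpace E] [BorelSpace E]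

/-- The Laplace transform of the squared norm of a standard Gaussian vector. -/
lemma integral_exp_neg_mul_norm_sq_stdGaussian {s : ℝ} (hs : 0 ≤ s) :
    ∫ x, Real.exp (-s * ‖x‖ ^ 2) ∂(stdGaussian E) =
      (√(1 + 2 * s))⁻¹ ^ Module.finrank ℝ E := by
  rw [stdGaussian, integral_map (Measurable.aemeasurable (by fun_prop))
    (Measurable.aestronglyMeasurable (by fun_prop))]
  simp_rw [norm_sq_sum_smul_orthonormalBasis, Finset.mul_sum, Real.exp_sum]
  rw [integral_fintype_prod_eq_pow (fun x : ℝ ↦ Real.exp (-s * x ^ 2)),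
    integral_exp_neg_mul_sq_gaussianReal hs, Fintype.card_fin]

lemma integrable_sq_gaussianReal : Integrable (fun x : ℝ ↦ x ^ 2) (gaussianReal 0 1) :=
  IsGaussian.memLp_two_id.integrable_sq

lemma integral_sq_gaussianReal : ∫ x : ℝ, x ^ 2 ∂(gaussianReal 0 1) = 1 := by
  have h := variance_of_integral_eq_zero (μ := gaussianReal 0 1) (X := id) aemeasurable_id
    (by simp)
  rw [variance_id_gaussianReal] at h
  simpa using h.symm

lemma integrable_norm_sq_stdGaussian :
    Integrable (fun x ↦ ‖x‖ ^ 2) (stdGaussian E) :=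
  (memLp_two_iff_integrable_sq_norm aestronglyMeasurable_id).1 IsGaussian.memLp_two_id

lemma integral_norm_sq_stdGaussian :
    ∫ x, ‖x‖ ^ 2 ∂(stdGaussian E) = Module.finrank ℝ E := by
  rw [stdGaussian, integral_map (Measurable.aemeasurable (by fun_prop))
    (Measurable.aestronglyMeasurable (by fun_prop))]
  simp_rw [norm_sq_sum_smul_orthonormalBasis]
  have hint : ∀ i, Integrable (fun x : Fin (Module.finrank ℝ E) → ℝ ↦ x i ^ 2)
      (Measure.pi fun _ ↦ gaussianReal 0 1) := fun i ↦
    integrable_comp_eval (μ := fun _ ↦ gaussianReal 0 1) (f := fun y : ℝ ↦ y ^ 2)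
      integrable_sq_gaussianReal
  rw [integral_finsetSum _ fun i _ ↦ hint i]
  simp_rw [integral_comp_eval (μ := fun _ ↦ gaussianReal 0 1) (f := fun y : ℝ ↦ y ^ 2)
    integrable_sq_gaussianReal.aestronglyMeasurable, integral_sq_gaussianReal]
  simp

/-- A sum of independent standard Gaussian vectors transformed by linear maps whose adjoints `L'`
satisfy `∑ ‖L' k t‖² = ‖t‖²` is a standard Gaussian vector. -/
lemma map_sum_pi_stdGaussian {ι : Type*} [Fintype ι] (L : ι → E → E) (L' : ι → E → E)
    (hL : ∀ k, Measurable (L k)) (hadj : ∀ k z t, inner ℝ (L k z) t = inner ℝ z (L' k t))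
    (hnorm : ∀ t, ∑ k, ‖L' k t‖ ^ 2 = ‖t‖ ^ 2) :
    (Measure.pi fun _ : ι ↦ stdGaussian E).map (fun z ↦ ∑ k, L k (z k)) = stdGaussian E := by
  have hm : Measurable fun z : ι → E ↦ ∑ k, L k (z k) := by fun_prop
  have := Measure.isProbabilityMeasure_map (μ := Measure.pi fun _ : ι ↦ stdGaussian E)
    hm.aemeasurable
  -- By independence the characteristic function is a product of Gaussian factors, whose exponents
  -- add up by `hnorm`.
  apply Measure.ext_of_charFun
  ext t
  rw [charFun_stdGaussian, charFun_apply, integral_map hm.aemeasurable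
    (Measurable.aestronglyMeasurable (by fun_prop))]
  simp_rw [sum_inner, Complex.ofReal_sum, Finset.sum_mul, Complex.exp_sum, hadj]
  rw [integral_fintype_prod_eq_prod
    (f := fun k x ↦ Complex.exp ((inner ℝ x (L' k t) : ℝ) * Complex.I))]
  simp_rw [← charFun_apply, charFun_stdGaussian, ← Complex.exp_sum, ← Finset.sum_div,
    Finset.sum_neg_distrib, ← Complex.ofReal_pow, ← Complex.ofReal_sum, hnorm]

end StdGaussian

/-- Every combination of independent copies of `ν` with coefficients of `ℓ²`-norm one has
law `ν`. -/
def IsRotationStable {𝕜 : Type*} [RCLike 𝕜] [MeasurableSpace 𝕜] (ν : Measure 𝕜) : Prop :=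
  ∀ (n : ℕ) (a : Fin n → 𝕜), ∑ k, ‖a k‖ ^ 2 = 1 →
    (Measure.pi fun _ : Fin n ↦ ν).map (fun z ↦ ∑ k, a k * z k) = ν

lemma isRotationStable_stdGaussian_real : IsRotationStable (stdGaussian ℝ) := by
  intro n a ha
  refine map_sum_pi_stdGaussian (fun k z ↦ a k * z) (fun k t ↦ a k * t) (by fun_prop) ?_ ?_
  · intro k z t
    simp only [inner, RCLike.re_to_real, RCLike.star_def, conj_trivial]
    ring
  · intro t
    simp_rw [norm_mul, mul_pow, ← Finset.sum_mul, ha, one_mul]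

lemma isRotationStable_stdGaussian_complex : IsRotationStable (stdGaussian ℂ) := by
  intro n a ha
  refine map_sum_pi_stdGaussian (fun k z ↦ a k * z) (fun k t ↦ star (a k) * t) (by fun_prop) ?_ ?_
  · intro k z t
    simp only [Complex.inner, map_mul, RCLike.star_def]
    ring_nf
  · intro t
    simp_rw [norm_mul, norm_star, mul_pow, ← Finset.sum_mul, ha, one_mul]

lemma norm_sqrt_mul_sq {𝕜 : Type*} [RCLike 𝕜] {c : ℝ} (hc : 0 ≤ c) (x : 𝕜) :
    ‖((√c : ℝ) : 𝕜) * x‖ ^ 2 = c * ‖x‖ ^ 2 := by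
  rw [norm_mul, mul_pow, RCLike.norm_ofReal, sq_abs, Real.sq_sqrt hc]

/-! ### Randomized rounding for sums of squares of linear forms. -/

section Rounding

variable {𝕜 : Type*} [RCLike 𝕜] [MeasurableSpace 𝕜] [BorelSpace 𝕜] {ν : Measure 𝕜}
  [IsProbabilityMeasure ν] {n : ℕ}

/-- Normalising the coefficients reduces to the unit-norm case. Integrals over the product law of
functions of one linear form thus become scalar integrals. -/
lemma IsRotationStable.map_sum_mul (hν : IsRotationStable ν) (a : Fin n → 𝕜) :
    (Measure.pi fun _ : Fin n ↦ ν).map (fun z ↦ ∑ k, a k * z k) =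
      ν.map (fun x ↦ ((√(∑ k, ‖a k‖ ^ 2) : ℝ) : 𝕜) * x) := by
  have h0 : 0 ≤ ∑ k, ‖a k‖ ^ 2 := by positivity
  rcases h0.eq_or_lt with h | h
  · have ha : ∀ k, a k = 0 := fun k ↦ by
      simpa using (Finset.sum_eq_zero_iff_of_nonneg fun k _ ↦ by positivity).1 h.symm k
        (Finset.mem_univ k)
    simp [ha]
  · set r := √(∑ k, ‖a k‖ ^ 2) with hr
    have hr0 : 0 < r := Real.sqrt_pos.2 h
    have hrk : (r : 𝕜) ≠ 0 := by exact_mod_cast hr0.ne'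
    have hunit : ∑ k, ‖(r : 𝕜)⁻¹ * a k‖ ^ 2 = 1 := by
      simp_rw [norm_mul, mul_pow, ← Finset.mul_sum, norm_inv, RCLike.norm_ofReal, abs_of_pos hr0]
      rw [inv_pow, hr, Real.sq_sqrt h0, inv_mul_cancel₀ h.ne']
    conv_rhs => rw [← hν n _ hunit]
    rw [Measure.map_map (by fun_prop) (by fun_prop)]
    congr 1
    ext z
    simp only [Function.comp_apply, Finset.mul_sum]
    refine Finset.sum_congr rfl fun k _ ↦ ?_
    rw [← mul_assoc, mul_inv_cancel_left₀ hrk]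

lemma IsRotationStable.integral_comp_norm_sq (hν : IsRotationStable ν) (a : Fin n → 𝕜)
    {f : ℝ → ℝ} (hf : Measurable f) :
    ∫ z, f (‖∑ k, a k * z k‖ ^ 2) ∂(Measure.pi fun _ : Fin n ↦ ν) =
      ∫ x, f ((∑ k, ‖a k‖ ^ 2) * ‖x‖ ^ 2) ∂ν := by
  have h := integral_map (μ := Measure.pi fun _ : Fin n ↦ ν) (φ := fun z ↦ ∑ k, a k * z k)
    (f := fun x ↦ f (‖x‖ ^ 2)) (Measurable.aemeasurable (by fun_prop))
    (Measurable.aestronglyMeasurable (by fun_prop))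
  rw [← h, hν.map_sum_mul, integral_map (by fun_prop)
    (Measurable.aestronglyMeasurable (by fun_prop))]
  simp_rw [norm_sqrt_mul_sq (show 0 ≤ ∑ k, ‖a k‖ ^ 2 by positivity)]

lemma IsRotationStable.integrable_norm_sq (hν : IsRotationStable ν)
    (hint : Integrable (fun x ↦ ‖x‖ ^ 2) ν) (a : Fin n → 𝕜) :
    Integrable (fun z ↦ ‖∑ k, a k * z k‖ ^ 2) (Measure.pi fun _ : Fin n ↦ ν) := by
  have h := integrable_map_measure (μ := Measure.pi fun _ : Fin n ↦ ν)
    (f := fun z ↦ ∑ k, a k * z k) (g := fun x : 𝕜 ↦ ‖x‖ ^ 2)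
    (Measurable.aestronglyMeasurable (by fun_prop)) (Measurable.aemeasurable (by fun_prop))
  refine h.1 ?_
  rw [hν.map_sum_mul, integrable_map_measure (Measurable.aestronglyMeasurable (by fun_prop))
    (by fun_prop)]
  simp_rw [Function.comp_def, norm_sqrt_mul_sq (show 0 ≤ ∑ k, ‖a k‖ ^ 2 by positivity)]
  exact hint.const_mul _

lemma integrable_exp_neg {Ω : Type*} [MeasurableSpace Ω] {μ : Measure Ω} [IsFiniteMeasure μ]
    {f : Ω → ℝ} (hf : Measurable f) (hf0 : ∀ x, 0 ≤ f x) :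
    Integrable (fun x ↦ Real.exp (-f x)) μ := by
  refine Integrable.of_bound (Measurable.aestronglyMeasurable (by fun_prop)) 1 (ae_of_all _ ?_)
  intro x
  rw [Real.norm_eq_abs, Real.abs_exp, Real.exp_le_one_iff]
  linarith [hf0 x]

variable {m : ℕ}

lemma IsRotationStable.integral_sum_norm_sq (hν : IsRotationStable ν)
    (hint : Integrable (fun x ↦ ‖x‖ ^ 2) ν) (G : Fin m → Fin n → 𝕜) :
    ∫ z, ∑ j, ‖∑ k, G j k * z k‖ ^ 2 ∂(Measure.pi fun _ : Fin n ↦ ν) =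
      (∑ j, ∑ k, ‖G j k‖ ^ 2) * ∫ x, ‖x‖ ^ 2 ∂ν := by
  rw [integral_finsetSum _ fun j _ ↦ hν.integrable_norm_sq hint _, Finset.sum_mul]
  refine Finset.sum_congr rfl fun j _ ↦ ?_
  rw [hν.integral_comp_norm_sq (G j) (f := fun y ↦ y) measurable_id, integral_const_mul]

/-- Among the quadratic forms `‖G z‖²` of trace at least one, the Laplace transform is largest
at the form `|z|²` of rank one. -/
lemma IsRotationStable.integral_exp_neg_le (hν : IsRotationStable ν)
    (G : Fin m → Fin n → 𝕜) (hG : 1 ≤ ∑ j, ∑ k, ‖G j k‖ ^ 2) {s : ℝ} (hs : 0 ≤ s) :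
    ∫ z, Real.exp (-(s * ∑ j, ‖∑ k, G j k * z k‖ ^ 2)) ∂(Measure.pi fun _ : Fin n ↦ ν) ≤
      ∫ x, Real.exp (-(s * ‖x‖ ^ 2)) ∂ν := by
  set t := ∑ j, ∑ k, ‖G j k‖ ^ 2 with ht
  have ht0 : 0 < t := by linarith
  set c : Fin m → ℝ := fun j ↦ ∑ k, ‖G j k‖ ^ 2 with hc
  have hc0 : ∀ j, 0 ≤ c j := fun j ↦ by positivity
  -- Jensen for `exp` with weights `c j / t`. In law, the `j`-th rescaled square is `(t / c j) * c j
  -- * ‖x‖² = t * ‖x‖²`, and `t ≥ 1`. If `c j = 0`, the weight and the row both vanish.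
  have hpt : ∀ z : Fin n → 𝕜, Real.exp (-(s * ∑ j, ‖∑ k, G j k * z k‖ ^ 2)) ≤
      ∑ j, c j / t * Real.exp (-(s * (t / c j) * ‖∑ k, G j k * z k‖ ^ 2)) := by
    intro z
    have := convexOn_exp.map_sum_le (t := Finset.univ) (w := fun j ↦ c j / t)
      (p := fun j ↦ -(s * (t / c j) * ‖∑ k, G j k * z k‖ ^ 2))
      (fun j _ ↦ by have := hc0 j; positivity) (by rw [← Finset.sum_div]; exact div_self ht0.ne')
      (fun _ _ ↦ Set.mem_univ _)
    simp only [smul_eq_mul] at this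
    refine le_of_eq_of_le ?_ this
    congr 1
    rw [Finset.mul_sum, ← Finset.sum_neg_distrib]
    refine Finset.sum_congr rfl fun j _ ↦ ?_
    rcases (hc0 j).eq_or_lt with h | h
    · have hz : ∀ k, G j k = 0 := fun k ↦ by
        simpa using (Finset.sum_eq_zero_iff_of_nonneg fun k _ ↦ by positivity).1 h.symm k
          (Finset.mem_univ k)
      simp [hz]
    · field_simp
  have hint : ∀ j, Integrable (fun z : Fin n → 𝕜 ↦
      c j / t * Real.exp (-(s * (t / c j) * ‖∑ k, G j k * z k‖ ^ 2)))
      (Measure.pi fun _ : Fin n ↦ ν) := fun j ↦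
    (integrable_exp_neg (by fun_prop) fun z ↦ by have := hc0 j; positivity).const_mul _
  calc _ ≤ ∫ z, ∑ j, c j / t * Real.exp (-(s * (t / c j) * ‖∑ k, G j k * z k‖ ^ 2))
        ∂(Measure.pi fun _ : Fin n ↦ ν) :=
        integral_mono (integrable_exp_neg (by fun_prop) fun z ↦ by positivity)
          (integrable_finsetSum _ fun j _ ↦ hint j) hpt
    _ = ∑ j, c j / t * ∫ x, Real.exp (-(s * (t / c j) * (c j * ‖x‖ ^ 2))) ∂ν := by
        rw [integral_finsetSum _ fun j _ ↦ hint j]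
        refine Finset.sum_congr rfl fun j _ ↦ ?_
        rw [integral_const_mul, hν.integral_comp_norm_sq (G j)
          (f := fun y ↦ Real.exp (-(s * (t / c j) * y))) (by fun_prop)]
    _ ≤ ∑ j, c j / t * ∫ x, Real.exp (-(s * ‖x‖ ^ 2)) ∂ν := by
        refine Finset.sum_le_sum fun j _ ↦ ?_
        rcases (hc0 j).eq_or_lt with h | h
        · simp [← h]
        · refine mul_le_mul_of_nonneg_left ?_ (by positivity)
          refine integral_mono (integrable_exp_neg (by fun_prop) fun x ↦ by positivity)
            (integrable_exp_neg (by fun_prop) fun x ↦ by positivity) fun x ↦ ?_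
          rw [Real.exp_le_exp, neg_le_neg_iff, ← mul_assoc, mul_assoc s, div_mul_cancel₀ _ h.ne',
            mul_assoc]
          exact mul_le_mul_of_nonneg_left (le_mul_of_one_le_left (by positivity) hG) hs
    _ = _ := by
        rw [← Finset.sum_mul, ← Finset.sum_div, div_self ht0.ne', one_mul]

/-- Randomized rounding: if the quadratic forms `‖G i z‖²` have trace at least one, some `z`
makes all of them large compared with `‖U z‖²`. -/
lemma IsRotationStable.exists_norm_sq_lt (hν : IsRotationStable ν)
    (hint : Integrable (fun x ↦ ‖x‖ ^ 2) ν) {p : ℕ} {ι : Type*} (S : Finset ι)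
    (G : ι → Fin m → Fin n → 𝕜) (hG : ∀ i ∈ S, 1 ≤ ∑ j, ∑ k, ‖G i j k‖ ^ 2)
    (U : Fin p → Fin n → 𝕜) (hU : 0 < ∑ j, ∑ k, ‖U j k‖ ^ 2) {s c : ℝ} (hs : 0 ≤ s)
    (hc : 0 < c) (hlt : S.card * ∫ x, Real.exp (-(s * ‖x‖ ^ 2)) ∂ν +
      s / c * ∫ x, ‖x‖ ^ 2 ∂ν < 1) :
    ∃ z : Fin n → 𝕜, ∀ i ∈ S, ∑ j, ‖∑ k, U j k * z k‖ ^ 2 <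
      c * (∑ j, ∑ k, ‖U j k‖ ^ 2) * ∑ j, ‖∑ k, G i j k * z k‖ ^ 2 := by
  by_contra! hcon
  set T := ∑ j, ∑ k, ‖U j k‖ ^ 2 with hT
  refine hlt.not_ge ?_
  have hintE : ∀ i ∈ S, Integrable
      (fun z : Fin n → 𝕜 ↦ Real.exp (-(s * ∑ j, ‖∑ k, G i j k * z k‖ ^ 2)))
      (Measure.pi fun _ : Fin n ↦ ν) :=
    fun i _ ↦ integrable_exp_neg (by fun_prop) fun z ↦ by positivity
  have hintU : Integrable (fun z : Fin n → 𝕜 ↦ s / (c * T) * ∑ j, ‖∑ k, U j k * z k‖ ^ 2)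
      (Measure.pi fun _ : Fin n ↦ ν) :=
    (integrable_finsetSum _ fun j _ ↦ hν.integrable_norm_sq hint (U j)).const_mul _
  -- The index violated at `z` supplies `1 ≤ e^{-x} + x`; the other exponentials are nonnegative.
  have hpt : ∀ z : Fin n → 𝕜, 1 ≤ (∑ i ∈ S, Real.exp (-(s * ∑ j, ‖∑ k, G i j k * z k‖ ^ 2))) +
      s / (c * T) * ∑ j, ‖∑ k, U j k * z k‖ ^ 2 := by
    intro z
    obtain ⟨i, hi, hz⟩ := hcon z
    have h1 := Finset.single_le_sum
      (f := fun i ↦ Real.exp (-(s * ∑ j, ‖∑ k, G i j k * z k‖ ^ 2)))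
      (fun i _ ↦ (Real.exp_pos _).le) hi
    have h2 := Real.add_one_le_exp (-(s * ∑ j, ‖∑ k, G i j k * z k‖ ^ 2))
    have h3 : s * ∑ j, ‖∑ k, G i j k * z k‖ ^ 2 ≤
        s / (c * T) * ∑ j, ‖∑ k, U j k * z k‖ ^ 2 := by
      calc _ = s / (c * T) * (c * T * ∑ j, ‖∑ k, G i j k * z k‖ ^ 2) := by field_simp
        _ ≤ _ := mul_le_mul_of_nonneg_left hz (by positivity)
    linarith
  calc (1 : ℝ) = ∫ _, (1 : ℝ) ∂(Measure.pi fun _ : Fin n ↦ ν) := by simp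
    _ ≤ ∫ z : Fin n → 𝕜, ((∑ i ∈ S, Real.exp (-(s * ∑ j, ‖∑ k, G i j k * z k‖ ^ 2))) +
        s / (c * T) * ∑ j, ‖∑ k, U j k * z k‖ ^ 2) ∂(Measure.pi fun _ : Fin n ↦ ν) :=
        integral_mono (integrable_const _) ((integrable_finsetSum _ hintE).add hintU) hpt
    _ = (∑ i ∈ S, ∫ z, Real.exp (-(s * ∑ j, ‖∑ k, G i j k * z k‖ ^ 2))
          ∂(Measure.pi fun _ : Fin n ↦ ν)) + s / (c * T) * (T * ∫ x, ‖x‖ ^ 2 ∂ν) := by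
        rw [integral_add (integrable_finsetSum _ hintE) hintU, integral_finsetSum _ hintE,
          integral_const_mul, hν.integral_sum_norm_sq hint]
    _ ≤ _ := by
        refine add_le_add ?_ (le_of_eq (by field_simp))
        rw [← nsmul_eq_mul]
        exact Finset.sum_le_card_nsmul _ _ _ fun i hi ↦ hν.integral_exp_neg_le (G i) (hG i hi) hs

end Rounding

/-! ### From trace inequalities to sums of squares. -/

section Matrix

open Matrix

variable {𝕜 : Type*} [RCLike 𝕜] {m n : ℕ}

open scoped MatrixOrder in
lemma Matrix.PosSemidef.exists_eq_conjTranspose_mul_self {A : Matrix (Fin n) (Fin n) 𝕜}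
    (hA : A.PosSemidef) : ∃ B : Matrix (Fin n) (Fin n) 𝕜, A = Bᴴ * B :=
  CStarAlgebra.nonneg_iff_eq_star_mul_self.mp hA.nonneg

lemma re_trace_mul_conjTranspose_self (A : Matrix (Fin m) (Fin n) 𝕜) :
    RCLike.re (A * Aᴴ).trace = ∑ j, ∑ k, ‖A j k‖ ^ 2 := by
  simp only [Matrix.trace, Matrix.diag_apply, Matrix.mul_apply, Matrix.conjTranspose_apply,
    map_sum, RCLike.star_def, RCLike.mul_conj]
  refine Finset.sum_congr rfl fun j _ ↦ Finset.sum_congr rfl fun k _ ↦ ?_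
  rw [← RCLike.ofReal_pow, RCLike.ofReal_re]

lemma re_dotProduct_conjTranspose_mul_self_mulVec (C : Matrix (Fin m) (Fin n) 𝕜)
    (w : Fin n → 𝕜) :
    RCLike.re (star w ⬝ᵥ (Cᴴ * C) *ᵥ w) = ∑ j, ‖(C *ᵥ w) j‖ ^ 2 := by
  rw [← Matrix.mulVec_mulVec, Matrix.dotProduct_mulVec, Matrix.vecMul_conjTranspose, star_star]
  simp only [dotProduct, Pi.star_apply, map_sum, RCLike.star_def, RCLike.conj_mul]
  refine Finset.sum_congr rfl fun j _ ↦ ?_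
  rw [← RCLike.ofReal_pow, RCLike.ofReal_re]

/-- Rounding of a positive semidefinite `X` with `Tr (H i X) ≥ 1` to a vector. -/
lemma IsRotationStable.exists_vector_of_trace_ge [MeasurableSpace 𝕜] [BorelSpace 𝕜]
    {ν : Measure 𝕜} [IsProbabilityMeasure ν] (hν : IsRotationStable ν)
    (hint : Integrable (fun x ↦ ‖x‖ ^ 2) ν) {ι : Type*} (S : Finset ι) (hS : S.Nonempty)
    (H : ι → Matrix (Fin n) (Fin n) 𝕜) (hH : ∀ i, (H i).PosSemidef)
    (X : Matrix (Fin n) (Fin n) 𝕜) (hX : X.PosSemidef)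
    (htr : ∀ i ∈ S, 1 ≤ RCLike.re (H i * X).trace) {s c : ℝ} (hs : 0 ≤ s)
    (hc : 0 < c) (hlt : S.card * ∫ x, Real.exp (-(s * ‖x‖ ^ 2)) ∂ν +
      s / c * ∫ x, ‖x‖ ^ 2 ∂ν < 1) :
    ∃ w : Fin n → 𝕜, ∀ i ∈ S, ∑ j, ‖w j‖ ^ 2 <
      c * RCLike.re X.trace * RCLike.re (star w ⬝ᵥ H i *ᵥ w) := by
  choose C hC using fun i ↦ (hH i).exists_eq_conjTranspose_mul_self
  obtain ⟨B, rfl⟩ := hX.exists_eq_conjTranspose_mul_self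
  have hT : RCLike.re (Bᴴ * B).trace = ∑ j, ∑ k, ‖Bᴴ j k‖ ^ 2 := by
    rw [← re_trace_mul_conjTranspose_self, conjTranspose_conjTranspose]
  have hG : ∀ i ∈ S, 1 ≤ ∑ j, ∑ k, ‖(C i * Bᴴ) j k‖ ^ 2 := by
    intro i hi
    rw [← re_trace_mul_conjTranspose_self, conjTranspose_mul, conjTranspose_conjTranspose]
    refine (htr i hi).trans_eq ?_
    rw [hC i, Matrix.mul_assoc, Matrix.trace_mul_comm]
    simp only [Matrix.mul_assoc]
  -- If `B = 0`, every trace would vanish, against the bound 1 on the nonempty `S`.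
  have hpos : 0 < ∑ j, ∑ k, ‖Bᴴ j k‖ ^ 2 := by
    have h0 : 0 ≤ ∑ j, ∑ k, ‖Bᴴ j k‖ ^ 2 := by positivity
    refine h0.lt_of_ne fun h ↦ ?_
    obtain ⟨i, hi⟩ := hS
    have hB : Bᴴ = 0 := by
      ext j k
      have h1 := (Finset.sum_eq_zero_iff_of_nonneg fun j _ ↦ by positivity).1 h.symm j
        (Finset.mem_univ j)
      have h2 := (Finset.sum_eq_zero_iff_of_nonneg fun k _ ↦ by positivity).1 h1 k
        (Finset.mem_univ k)
      exact norm_eq_zero.1 ((pow_eq_zero_iff two_ne_zero).1 h2)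
    have := hG i hi
    norm_num [hB] at this
  obtain ⟨z, hz⟩ := hν.exists_norm_sq_lt hint S (fun i ↦ C i * Bᴴ) hG Bᴴ hpos hs hc hlt
  refine ⟨Bᴴ *ᵥ z, fun i hi ↦ ?_⟩
  rw [hT, hC i, re_dotProduct_conjTranspose_mul_self_mulVec, Matrix.mulVec_mulVec]
  exact hz i hi

end Matrix

/-! ### Selecting indices and assembling the bound. -/

/-- Among numbers in `[0, 1]` with sum `Q`, at least `Q` are at least `1 / (M - Q + 1)`. -/
lemma exists_finset_card_eq_of_sum_eq {M Q : ℕ} (hQM : Q + 1 ≤ M) (β : Fin M → ℝ)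
    (hβ : ∀ i, 0 ≤ β i ∧ β i ≤ 1) (hsum : ∑ i, β i = Q) :
    ∃ S : Finset (Fin M), S.card = Q ∧ ∀ i ∈ S, 1 ≤ ((M : ℝ) - Q + 1) * β i := by
  classical
  set t : ℝ := (M : ℝ) - Q + 1 with ht
  have hQM' : (Q : ℝ) + 1 ≤ M := by exact_mod_cast hQM
  set F := Finset.univ.filter fun i ↦ 1 ≤ t * β i with hF
  by_cases hcard : Q ≤ F.card
  · obtain ⟨S, hSF, hS⟩ := Finset.exists_subset_card_eq hcard
    exact ⟨S, hS, fun i hi ↦ (Finset.mem_filter.1 (hSF hi)).2⟩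
  · exfalso
    have hk : (F.card : ℝ) + 1 ≤ Q := by exact_mod_cast not_le.1 hcard
    have hcompl : (Fᶜ.card : ℝ) = M - F.card := by
      rw [Finset.card_compl, Fintype.card_fin, Nat.cast_sub]
      simpa using Finset.card_le_univ F
    have hne : Fᶜ.Nonempty := by
      rw [← Finset.card_pos]
      have : (0 : ℝ) < Fᶜ.card := by rw [hcompl]; linarith
      exact_mod_cast this
    have h1 : ∑ i ∈ F, t * β i ≤ F.card * t := by
      rw [← nsmul_eq_mul]
      exact Finset.sum_le_card_nsmul _ _ _ fun i _ ↦
        mul_le_of_le_one_right (by linarith) (hβ i).2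
    have h2 : ∑ i ∈ Fᶜ, t * β i < Fᶜ.card * 1 := by
      rw [← nsmul_eq_mul, ← Finset.sum_const]
      refine Finset.sum_lt_sum_of_nonempty hne fun i hi ↦ ?_
      simpa [hF] using hi
    have h3 : ∑ i ∈ F, t * β i + ∑ i ∈ Fᶜ, t * β i = t * Q := by
      rw [Finset.sum_add_sum_compl, ← Finset.mul_sum, hsum]
    -- With `k = F.card`, the estimates give `t * Q < k * t + (M - k)`, that is `(M - Q) * (Q - k -
    -- 1) < 0`, although both factors are nonnegative.
    nlinarith

/-- Rescaling `w` so that the smallest form over `S` equals 1 makes it feasible with `β` the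
indicator of `S`. Off `S`, with `ε = 0`, positive semidefiniteness suffices. -/
lemma vQPmin_le_of_forall_lt {𝕜 : Type*} [RCLike 𝕜] {M N Q : ℕ}
    (H : Fin M → Matrix (Fin N) (Fin N) 𝕜) (hH : ∀ i, (H i).PosSemidef) {S : Finset (Fin M)}
    (hS : S.card = Q) (hQ : 1 ≤ Q) {r : ℝ} (w : Fin N → 𝕜)
    (hw : ∀ i ∈ S, ∑ j, ‖w j‖ ^ 2 <
      r * RCLike.re (dotProduct (star w) ((H i).mulVec w))) :
    vQPmin H Q 0 ≤ (r : EReal) := by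
  classical
  set q : Fin M → ℝ := fun i ↦ RCLike.re (dotProduct (star w) ((H i).mulVec w)) with hq
  have hq0 : ∀ i, 0 ≤ q i := fun i ↦ (RCLike.nonneg_iff.1 ((hH i).dotProduct_mulVec_nonneg w)).1
  have hSn : S.Nonempty := Finset.card_pos.1 (by omega)
  obtain ⟨i₀, hi₀, hmin⟩ := S.exists_min_image q hSn
  have hlt := hw i₀ hi₀
  have hw0 : 0 ≤ ∑ j, ‖w j‖ ^ 2 := by positivity
  -- Strictness of `hw` excludes a vanishing form.
  have hpos : 0 < q i₀ := (hq0 i₀).lt_of_ne fun h ↦ by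
    change _ < r * q i₀ at hlt
    rw [← h, mul_zero] at hlt
    linarith
  set a : ℝ := (√(q i₀))⁻¹ with ha
  have ha2 : a * a = (q i₀)⁻¹ := by
    rw [ha, ← mul_inv, Real.mul_self_sqrt hpos.le]
  have hfeas : QPFeasible H Q 0 (WithLp.toLp 2 ((a : 𝕜) • w)) (fun i ↦ if i ∈ S then 1 else 0) := by
    refine ⟨fun i ↦ ?_, ?_, fun i ↦ ?_⟩
    · have hscale : RCLike.re (dotProduct (star ((a : 𝕜) • w)) ((H i).mulVec ((a : 𝕜) • w))) =
          (q i₀)⁻¹ * q i := by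
        rw [Matrix.mulVec_smul, star_smul, smul_dotProduct, dotProduct_smul, smul_eq_mul,
          smul_eq_mul, RCLike.star_def, RCLike.conj_ofReal, RCLike.re_ofReal_mul,
          RCLike.re_ofReal_mul, ← mul_assoc, ha2]
      simp only [hscale]
      split_ifs with hi
      · have := hmin i hi
        rw [inv_mul_eq_div]
        norm_num
        rwa [one_le_div hpos]
      · have := hq0 i
        norm_num
        positivity
    · simp [hS]
    · by_cases hi : i ∈ S <;> simp [hi]
  refine (iInf₂_le_of_le _ _ (iInf_le_of_le hfeas le_rfl)).trans ?_
  rw [EReal.coe_le_coe_iff, EuclideanSpace.norm_sq_eq]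
  simp only [Pi.smul_apply, smul_eq_mul, norm_mul, mul_pow, RCLike.norm_ofReal, sq_abs]
  rw [← Finset.mul_sum, pow_two, ha2, inv_mul_eq_div, div_le_iff₀ hpos]
  exact hlt.le

/-- The approximation bound delivered by a rotation stable rounding distribution. -/
lemma IsRotationStable.vQPmin_le {𝕜 : Type*} [RCLike 𝕜] [MeasurableSpace 𝕜] [BorelSpace 𝕜]
    {ν : Measure 𝕜} [IsProbabilityMeasure ν] (hν : IsRotationStable ν)
    (hint : Integrable (fun x ↦ ‖x‖ ^ 2) ν) {M N Q : ℕ} (hQ : 1 ≤ Q) (hQM : Q + 1 ≤ M)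
    (H : Fin M → Matrix (Fin N) (Fin N) 𝕜) (hH : ∀ i, (H i).PosSemidef) {s c : ℝ} (hs : 0 ≤ s)
    (hc : 0 < c) (hlt : Q * ∫ x, Real.exp (-(s * ‖x‖ ^ 2)) ∂ν +
      s / c * ∫ x, ‖x‖ ^ 2 ∂ν < 1) :
    vQPmin H Q 0 ≤ ((c * ((M : ℝ) - Q + 1) : ℝ) : EReal) * vSDP2min H Q 0 := by
  have hQM' : (Q : ℝ) + 1 ≤ M := by exact_mod_cast hQM
  set t : ℝ := (M : ℝ) - Q + 1 with ht
  have ht0 : 0 < t := by linarith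
  have hpos : (0 : EReal) < ((c * t : ℝ) : EReal) := by exact_mod_cast mul_pos hc ht0
  -- Moving the positive finite constant to the left leaves a bare infimum, so one feasible point
  -- can be treated at a time.
  rw [← EReal.div_le_iff_le_mul hpos (EReal.coe_ne_top _)]
  refine le_iInf fun X ↦ le_iInf fun β ↦ le_iInf fun hX ↦ ?_
  rw [EReal.div_le_iff_le_mul hpos (EReal.coe_ne_top _), ← EReal.coe_mul]
  obtain ⟨S, hS, hSβ⟩ := exists_finset_card_eq_of_sum_eq hQM β hX.box hX.sum_eq
  have htrace : ∀ A : Matrix (Fin N) (Fin N) 𝕜,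
      RCLike.re (((t : 𝕜) • A).trace) = t * RCLike.re A.trace := fun A ↦ by
    rw [Matrix.trace_smul, smul_eq_mul, RCLike.re_ofReal_mul]
  obtain ⟨w, hw⟩ := hν.exists_vector_of_trace_ge hint S (Finset.card_pos.1 (by omega)) H hH
    ((t : 𝕜) • X) (hX.posSemidef.smul (by exact_mod_cast ht0.le)) (fun i hi ↦ by
      rw [Matrix.mul_smul, htrace]
      have h1 := hX.trace_ge i
      simp only [mul_one, mul_zero, add_zero] at h1
      exact (hSβ i hi).trans (mul_le_mul_of_nonneg_left h1 ht0.le)) hs hc (by rwa [hS])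
  refine vQPmin_le_of_forall_lt H hH hS hQ w fun i hi ↦ ?_
  have := hw i hi
  rwa [htrace, ← mul_assoc] at this

theorem mainTheorem3 (M N Q : ℕ) (hQ : 1 ≤ Q) (hQM : Q + 1 ≤ M) :
    (∀ H : Fin M → Matrix (Fin N) (Fin N) ℝ, (∀ i, (H i).PosSemidef) →
      vQPmin H Q 0 ≤
        ((27 * (Q : ℝ) ^ 2 * ((M : ℝ) - (Q : ℝ) + 1) / Real.pi : ℝ) : EReal) *
          vSDP2min H Q 0) ∧
    (∀ H : Fin M → Matrix (Fin N) (Fin N) ℂ, (∀ i, (H i).PosSemidef) →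
      vQPmin H Q 0 ≤
        ((max (8 * (Q : ℝ)) (24 * (Real.sqrt (Q : ℝ) - 1) ^ 2) *
            ((M : ℝ) - (Q : ℝ) + 1) : ℝ) : EReal) *
          vSDP2min H Q 0) := by
  have hQ0 : (0 : ℝ) < Q := by exact_mod_cast hQ
  constructor
  · intro H hH
    have hconst : 27 * (Q : ℝ) ^ 2 * ((M : ℝ) - (Q : ℝ) + 1) / Real.pi =
        27 * (Q : ℝ) ^ 2 / Real.pi * ((M : ℝ) - (Q : ℝ) + 1) := by ring
    rw [hconst]
    -- With `s = 2 Q²`, `Q L(s) = Q / √(1 + 4 Q²) ≤ 1/2`, and `s / c = 2π / 27 < 1/2`.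
    refine isRotationStable_stdGaussian_real.vQPmin_le integrable_norm_sq_stdGaussian hQ hQM H hH
      (s := 2 * (Q : ℝ) ^ 2) (by positivity) (by positivity) ?_
    have hL := integral_exp_neg_mul_norm_sq_stdGaussian (E := ℝ)
      (show 0 ≤ 2 * (Q : ℝ) ^ 2 by positivity)
    simp only [neg_mul] at hL
    rw [hL, integral_norm_sq_stdGaussian, Module.finrank_self, pow_one]
    have hsqrt : 2 * (Q : ℝ) ≤ √(1 + 2 * (2 * (Q : ℝ) ^ 2)) :=
      Real.le_sqrt_of_sq_le (by nlinarith)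
    have h1 : Q * (√(1 + 2 * (2 * (Q : ℝ) ^ 2)))⁻¹ ≤ 1 / 2 := by
      rw [← div_eq_mul_inv, div_le_iff₀ (by linarith)]
      linarith
    have h2 : 2 * (Q : ℝ) ^ 2 / (27 * (Q : ℝ) ^ 2 / Real.pi) = 2 * Real.pi / 27 := by
      field_simp
    rw [h2, Nat.cast_one, mul_one]
    linarith [Real.pi_lt_four]
  · intro H hH
    -- Only the bound `c ≥ 8 Q` is needed.
    have hc := le_max_left (8 * (Q : ℝ)) (24 * (Real.sqrt (Q : ℝ) - 1) ^ 2)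
    set c := max (8 * (Q : ℝ)) (24 * (Real.sqrt (Q : ℝ) - 1) ^ 2)
    have hc0 : 0 < c := by linarith
    -- Here `E|x|² = 2` and `L(s) = 1 / (1 + 2 s)`. With `s = Q` the two terms are at most `1/2` and
    -- `1/4`.
    refine isRotationStable_stdGaussian_complex.vQPmin_le integrable_norm_sq_stdGaussian hQ hQM
      H hH (s := Q) hQ0.le hc0 ?_
    have hL := integral_exp_neg_mul_norm_sq_stdGaussian (E := ℂ) hQ0.le
    simp only [neg_mul] at hL
    rw [hL, integral_norm_sq_stdGaussian, Complex.finrank_real_complex, inv_pow,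
      Real.sq_sqrt (by positivity)]
    have h1 : (Q : ℝ) * (1 + 2 * (Q : ℝ))⁻¹ ≤ 1 / 2 := by
      rw [← div_eq_mul_inv, div_le_iff₀ (by linarith)]
      linarith
    have h2 : (Q : ℝ) / c ≤ 1 / 8 := by
      rw [div_le_iff₀ hc0]
      linarith
    push_cast
    linarith
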